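/- Let $\mathcal{A}$ be a locally finitely presentable category, i.e. a (locally small) cocomplete category with a set of finitely presentable objects (objects whose covariant hom-functors preserve filtered colimits) such that every object of $\mathcal{A}$ is a filtered colimit of objects from this set. Suppose that $\mathcal{A}$ has a simple initial object $0$, i.e. every morphism with domain $0$ is a strong monomorphism (a monomorphism having the diagonal fill-in property with respect to all epimorphisms). Let $F\colon \mathcal{A} \to \mathcal{A}$ be an endofunctor preserving monomorphisms. Then $F$ has an initial algebra (an initial object in the category of $F$-algebras $(A, a\colon FA \to A)$ and algebra homomorphisms) if and only if $F$ has a pre-fixed point, i.e. an $F$-algebra $(A, m)$ whose structure morphism $m\colon FA \to A$ is a monomorphism. -/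

import Mathlib

universe v u

open CategoryTheory Limits

/-- A category has a *simple initial object* if it has an initial object `I` such that every
morphism with domain `I` is a strong monomorphism. -/
def HasSimpleInitial (C : Type*) [Category C] : Prop :=
  ∃ I : C, Nonempty (IsInitial I) ∧ ∀ (X : C) (f : I ⟶ X), StrongMono f

/-- A *pre-fixed point* of an endofunctor `F` is an `F`-algebra whose structure morphism
`F A ⟶ A` is a monomorphism. -/
def IsPreFixedPoint {C : Type*} [Category C] {F : C ⥤ C} (A : Endofunctor.Algebra F) : Prop :=
  Mono A.str

/-!
If `F` has an initial algebra, its structure morphism is invertible by Lambek's lemma, so it is a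
pre-fixed point.

Conversely, let `m : F A ⟶ A` be a monomorphism. The initial algebra is found as a subobject of
`A`, by Zorn's lemma. Call a coalgebra `c : U ⟶ F U` *recursive* if for every algebra
`b : F B ⟶ B` the equation `h = c ≫ F h ≫ b` has exactly one solution `h : U ⟶ B`. If `c` is
moreover invertible, then its inverse is an initial algebra (`Coalgebra.IsRecursive.isInitial`).
Consider the subobjects `u : U ⟶ A` that carry a recursive coalgebra structure with
`c ≫ F u ≫ m = u` (`RecursiveSubobject`).

* The unique morphism `0 ⟶ A` from the initial object is one of them; this is where simplicity of
  the initial object is used.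
* They are closed under nonempty chains: a filtered colimit of subobjects of `A` is again a
  subobject of `A`, because finitely presentable objects separate
  (`mono_desc_of_isFiltered`), and a colimit of recursive coalgebras is recursive
  (`Coalgebra.IsRecursive.of_isColimit`). Chains have colimits since the category is well-powered
  (`small_subobject_of_isCardinalFilteredGenerator`).
* They are closed under `(U, u, c) ↦ (F U, F u ≫ m, F c)`, and `c` exhibits `U` as contained
  in `F U`.

By the last point, `c` is invertible at a maximal element, so that it yields an initial algebra.
-/

/-! ### Subobjects in locally finitely presentable categories -/

/-- A subobject of `X` is determined by the set of morphisms `G ⟶ X`, with `G` in the generator,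
that factor through it, because its underlying object is a colimit of such objects `G`. -/
theorem small_subobject_of_isCardinalFilteredGenerator {C : Type u} [Category.{v} C]
    {κ : Cardinal.{v}} [Fact κ.IsRegular] {P : ObjectProperty C} [ObjectProperty.Small.{v} P]
    (hP : P.IsCardinalFilteredGenerator κ) (X : C) : Small.{v} (Subobject X) := by
  let factoring (Y : Subobject X) : Set (Σ G : Subtype P, G.1 ⟶ X) := {g | Y.Factors g.2}
  have le_of_subset (Y Z : Subobject X) (h : factoring Y ⊆ factoring Z) : Y ≤ Z := by
    obtain ⟨J, _, _, ⟨p⟩⟩ := hP.exists_colimitsOfShape (Y : C)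
    have hf (j : J) : Z.Factors (p.ι.app j ≫ Y.arrow) :=
      @h ⟨⟨_, p.prop_diag_obj j⟩, p.ι.app j ≫ Y.arrow⟩
        ((Subobject.factors_iff _ _).2 ⟨p.ι.app j, rfl⟩)
    let c : Cocone p.diag :=
      { pt := (Z : C)
        ι := { app := fun j => Z.factorThru _ (hf j)
               naturality := fun i j a => by
                rw [← cancel_mono Z.arrow]
                simp [p.w_assoc] } }
    refine Subobject.le_of_comm (p.isColimit.desc c) (p.isColimit.hom_ext fun j => ?_)
    rw [p.isColimit.fac_assoc]
    simp [c]
  refine small_of_injective (f := factoring) fun Y Z h => le_antisymm ?_ ?_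
  · exact le_of_subset _ _ h.le
  · exact le_of_subset _ _ h.ge

/-- A filtered colimit of monomorphisms with a fixed codomain is a monomorphism, when finitely
presentable objects separate. -/
theorem mono_desc_of_isFiltered {C : Type u} [Category.{v} C] {P : ObjectProperty C}
    (hP : P.IsSeparating) (hfp : ∀ G, P G → IsFinitelyPresentable.{v} G)
    {J : Type v} [SmallCategory J] [IsFiltered J] {D : J ⥤ C} {c : Cocone D} (hc : IsColimit c)
    (s : Cocone D) (hs : ∀ j, Mono (s.ι.app j)) : Mono (hc.desc s) := by
  refine ⟨fun {Z} f g hfg => hP _ _ fun G hG a => ?_⟩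
  have := hfp G hG
  obtain ⟨i, f', hf'⟩ := IsFinitelyPresentable.exists_hom_of_isColimit hc (a ≫ f)
  obtain ⟨j, g', hg'⟩ := IsFinitelyPresentable.exists_hom_of_isColimit hc (a ≫ g)
  have h : f' ≫ D.map (IsFiltered.leftToMax i j) = g' ≫ D.map (IsFiltered.rightToMax i j) := by
    have := hs (IsFiltered.max i j)
    rw [← cancel_mono (s.ι.app (IsFiltered.max i j)), Category.assoc, Category.assoc, s.w, s.w,
      ← hc.fac s i, ← hc.fac s j, reassoc_of% hf', reassoc_of% hg', hfg]
  rw [← hf', ← hg', ← c.w (IsFiltered.leftToMax i j), ← c.w (IsFiltered.rightToMax i j),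
    reassoc_of% h]

/-! ### Recursive coalgebras -/

/-- A coalgebra `c : U ⟶ F U` is *recursive* if for every algebra `b : F B ⟶ B` there is a unique
coalgebra-to-algebra morphism, that is, a unique `h : U ⟶ B` with `c ≫ F h ≫ b = h`. -/
def CategoryTheory.Endofunctor.Coalgebra.IsRecursive {C : Type u} [Category.{v} C] {F : C ⥤ C}
    (U : Endofunctor.Coalgebra F) : Prop :=
  ∀ B : Endofunctor.Algebra F, ∃! h : U.V ⟶ B.a, U.str ≫ F.map h ≫ B.str = h

namespace CategoryTheory.Endofunctor.Coalgebra.IsRecursive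

variable {C : Type u} [Category.{v} C] {F : C ⥤ C}

theorem of_isInitial (U : Coalgebra F) (hU : IsInitial U.V) : U.IsRecursive :=
  fun _ => ⟨hU.to _, hU.hom_ext _ _, fun _ _ => hU.hom_ext _ _⟩

theorem map {U : Coalgebra F} (hU : U.IsRecursive) :
    IsRecursive (F := F) ⟨F.obj U.V, F.map U.str⟩ := by
  intro B
  obtain ⟨h, hh, huniq⟩ := hU B
  refine ⟨F.map h ≫ B.str, ?_, fun g hg => ?_⟩
  · simp only [← F.map_comp_assoc, hh]
  · -- A solution `g` on `F U` restricts along `U.str` to a solution on `U`, which determines `g`.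
    have hg' : U.str ≫ g = h := huniq _ (by simpa using U.str ≫= hg)
    rw [← hg', F.map_comp_assoc]
    exact hg.symm

theorem of_isColimit {J : Type*} [Category* J] {K : J ⥤ Coalgebra F} (c : Cocone K)
    (hc : IsColimit ((Coalgebra.forget F).mapCocone c)) (hK : ∀ j, (K.obj j).IsRecursive) :
    c.pt.IsRecursive := by
  intro B
  choose h hh huniq using fun j => hK j B
  -- The solutions `h j` form a cocone, by uniqueness.
  let s : Cocone (K ⋙ Coalgebra.forget F) :=
    { pt := B.a
      ι := { app := h
             naturality := fun i j a => by
              have := huniq i ((K.map a).f ≫ h j) (by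
                simp only [F.map_comp_assoc]
                rw [(K.map a).h_assoc, hh j])
              exact this.trans (Category.comp_id _).symm } }
  obtain ⟨d, hd⟩ : ∃ d : c.pt.V ⟶ B.a, ∀ j, (c.ι.app j).f ≫ d = h j := ⟨hc.desc s, hc.fac s⟩
  have str_leg (j : J) : (K.obj j).str ≫ F.map (c.ι.app j).f = (c.ι.app j).f ≫ c.pt.str :=
    (c.ι.app j).h
  refine ⟨d, hc.hom_ext fun j => ?_, fun g hg => hc.hom_ext fun j => ?_⟩
  · change (c.ι.app j).f ≫ c.pt.str ≫ F.map d ≫ B.str = (c.ι.app j).f ≫ d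
    rw [← reassoc_of% str_leg j, ← F.map_comp_assoc, hd]
    exact hh j
  · change (c.ι.app j).f ≫ g = (c.ι.app j).f ≫ d
    rw [hd]
    refine huniq j _ ?_
    change c.pt.str ≫ F.map g ≫ B.str = g at hg
    rw [F.map_comp_assoc, reassoc_of% str_leg j, hg]

/-- The inverse of an invertible recursive coalgebra is an initial algebra. -/
noncomputable def isInitial {U : Coalgebra F} (hU : U.IsRecursive) [IsIso U.str] :
    IsInitial (⟨U.V, inv U.str⟩ : Algebra F) :=
  IsInitial.ofUniqueHom
    (fun B => ⟨(hU B).choose, by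
      rw [IsIso.eq_inv_comp]
      exact (hU B).choose_spec.1⟩)
    (fun B g => by
      ext
      exact (hU B).choose_spec.2 _ ((IsIso.eq_inv_comp _).1 g.h))

end CategoryTheory.Endofunctor.Coalgebra.IsRecursive

/-! ### Subobjects carrying a recursive coalgebra structure -/

/-- For an algebra `A`, a subobject `ι : U ⟶ A` together with a recursive coalgebra structure
on `U` for which `ι` is a coalgebra-to-algebra morphism. -/
structure RecursiveSubobject {C : Type u} [Category.{v} C] {F : C ⥤ C}
    (A : Endofunctor.Algebra F) where
  /-- the underlying coalgebra -/
  coalg : Endofunctor.Coalgebra F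
  /-- the inclusion into the algebra -/
  ι : coalg.V ⟶ A.a
  mono_ι : Mono ι
  comm : coalg.str ≫ F.map ι ≫ A.str = ι
  isRecursive : coalg.IsRecursive

namespace RecursiveSubobject

variable {C : Type u} [Category.{v} C] {F : C ⥤ C} {A : Endofunctor.Algebra F}

attribute [instance] mono_ι

/-- The subobject underlying a recursive subobject. -/
noncomputable def toSubobject (U : RecursiveSubobject A) : Subobject A.a := Subobject.mk U.ι

/-- Recursive subobjects are compared through their underlying subobjects. -/
noncomputable instance : Preorder (RecursiveSubobject A) := Preorder.lift toSubobject

/-- The application of `F`, as an operation on recursive subobjects of a pre-fixed point. -/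
def next [F.PreservesMonomorphisms] [Mono A.str] (U : RecursiveSubobject A) :
    RecursiveSubobject A where
  coalg := ⟨F.obj U.coalg.V, F.map U.coalg.str⟩
  ι := F.map U.ι ≫ A.str
  mono_ι := inferInstance
  comm := by simp only [← F.map_comp_assoc, U.comm]
  isRecursive := U.isRecursive.map

theorem isIso_str_of_isMax [F.PreservesMonomorphisms] [Mono A.str] {U : RecursiveSubobject A}
    (hU : IsMax U) : IsIso U.coalg.str := by
  have hle : U ≤ U.next := Subobject.mk_le_mk_of_comm U.coalg.str U.comm
  have hge : Subobject.mk (F.map U.ι ≫ A.str) ≤ Subobject.mk U.ι := hU hle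
  refine ⟨Subobject.ofMkLEMk _ _ hge, ?_, ?_⟩
  · rw [← cancel_mono U.ι, Category.assoc, Subobject.ofMkLEMk_comp, U.comm, Category.id_comp]
  · rw [← cancel_mono (F.map U.ι ≫ A.str), Category.assoc, U.comm, Subobject.ofMkLEMk_comp,
      Category.id_comp]

/-- The inclusion between comparable recursive subobjects is a coalgebra homomorphism. -/
noncomputable def homOfLE [F.PreservesMonomorphisms] [Mono A.str] {U V : RecursiveSubobject A}
    (h : U ≤ V) : U.coalg ⟶ V.coalg where
  f := Subobject.ofMkLEMk U.ι V.ι h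
  h := by
    have h' : Subobject.ofMkLEMk U.ι V.ι h ≫ V.ι = U.ι := Subobject.ofMkLEMk_comp h
    rw [← cancel_mono (F.map V.ι ≫ A.str), Category.assoc, Category.assoc, V.comm,
      ← F.map_comp_assoc, h', U.comm]

theorem homOfLE_ι [F.PreservesMonomorphisms] [Mono A.str] {U V : RecursiveSubobject A}
    (h : U ≤ V) : (homOfLE h).f ≫ V.ι = U.ι :=
  Subobject.ofMkLEMk_comp h

/-- A directed family of recursive subobjects has an upper bound, namely its colimit. -/
theorem exists_upperBound [F.PreservesMonomorphisms] [Mono A.str] {P : ObjectProperty C}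
    (hP : P.IsSeparating) (hfp : ∀ G, P G → IsFinitelyPresentable.{v} G)
    {J : Type v} [Preorder J] [Nonempty J] [IsDirectedOrder J] [HasColimitsOfShape J C]
    {U : J → RecursiveSubobject A} (hU : Monotone U) : ∃ V, ∀ j, U j ≤ V := by
  let K : J ⥤ Endofunctor.Coalgebra F :=
    { obj := fun j => (U j).coalg
      map := fun a => homOfLE (hU (leOfHom a))
      map_id := fun j => by
        ext
        rw [← cancel_mono (U j).ι, homOfLE_ι]
        exact (Category.id_comp _).symm
      map_comp := fun {i j k} a b => by
        ext
        rw [← cancel_mono (U k).ι, homOfLE_ι, Endofunctor.Coalgebra.comp_f, Category.assoc,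
          homOfLE_ι, homOfLE_ι] }
  let D : J ⥤ C := K ⋙ Endofunctor.Coalgebra.forget F
  let incl : Cocone D :=
    { pt := A.a
      ι := { app := fun j => (U j).ι
             naturality := fun i j a =>
              (homOfLE_ι (hU (leOfHom a))).trans (Category.comp_id _).symm } }
  let leg (j : J) : (U j).coalg.V ⟶ colimit D := colimit.ι D j
  have leg_w {i j : J} (a : i ⟶ j) : (K.map a).f ≫ leg j = leg i := colimit.w D a
  let strCocone : Cocone D :=
    { pt := F.obj (colimit D)
      ι := { app := fun j => (U j).coalg.str ≫ F.map (leg j)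
             naturality := fun i j a => by
              have h : (U i).coalg.str ≫ F.map (K.map a).f = (K.map a).f ≫ (U j).coalg.str :=
                (K.map a).h
              refine Eq.trans ?_ (Category.comp_id _).symm
              change (K.map a).f ≫ (U j).coalg.str ≫ F.map (leg j) =
                (U i).coalg.str ≫ F.map (leg i)
              rw [← reassoc_of% h, ← F.map_comp, leg_w] } }
  let L : Endofunctor.Coalgebra F := ⟨colimit D, colimit.desc D strCocone⟩
  let p : L.V ⟶ A.a := colimit.desc D incl
  have str_leg (j : J) : (U j).coalg.str ≫ F.map (leg j) = leg j ≫ L.str :=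
    (colimit.ι_desc strCocone j).symm
  have incl_leg (j : J) : leg j ≫ p = (U j).ι := colimit.ι_desc incl j
  let c : Cocone K :=
    { pt := L
      ι := { app := fun j => ⟨leg j, str_leg j⟩
             naturality := fun i j a => by
              ext
              exact (leg_w a).trans (Category.comp_id _).symm } }
  have : Mono p :=
    mono_desc_of_isFiltered hP hfp (colimit.isColimit D) incl fun j => (U j).mono_ι
  let V : RecursiveSubobject A :=
    { coalg := L
      ι := p
      mono_ι := this
      comm := colimit.hom_ext fun j => by
        change leg j ≫ L.str ≫ F.map p ≫ A.str = leg j ≫ p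
        rw [← reassoc_of% str_leg j, ← F.map_comp_assoc, incl_leg, (U j).comm]
      isRecursive := .of_isColimit c (colimit.isColimit D) fun j => (U j).isRecursive }
  exact ⟨V, fun j => Subobject.mk_le_mk_of_comm (f₂ := p) (leg j) (incl_leg j)⟩

end RecursiveSubobject

open Endofunctor in
theorem exists_isMax_recursiveSubobject {C : Type u} [Category.{v} C]
    [IsLocallyFinitelyPresentable.{v} C] (hC : HasSimpleInitial C) (F : C ⥤ C)
    [F.PreservesMonomorphisms] (A : Algebra F) [Mono A.str] :
    ∃ U : RecursiveSubobject A, IsMax U := by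
  have := Cardinal.fact_isRegular_aleph0.{v}
  obtain ⟨P, _, hP⟩ := HasCardinalFilteredGenerator.exists_small_generator C Cardinal.aleph0.{v}
  have : Small.{v} (Subobject A.a) := small_subobject_of_isCardinalFilteredGenerator hP A.a
  obtain ⟨I, ⟨hI⟩, hmono⟩ := hC
  have : Nonempty (RecursiveSubobject A) :=
    ⟨{ coalg := ⟨I, hI.to _⟩
       ι := hI.to _
       mono_ι := (hmono _ _).mono
       comm := hI.hom_ext _ _
       isRecursive := .of_isInitial _ hI }⟩
  refine zorn_le_nonempty fun s hs hne => ?_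
  -- The chain `s` need not be small, but the set of its underlying subobjects is.
  let t : Set (Subobject A.a) := RecursiveSubobject.toSubobject '' s
  choose r hr hrt using fun x : t => x.2
  have : Nonempty t := (hne.image _).to_subtype
  have ht : IsChain (· ≤ ·) t := by
    rintro _ ⟨x, hx, rfl⟩ _ ⟨y, hy, rfl⟩ -
    exact hs.total hx hy
  have : Nonempty (Shrink.{v} t) := (equivShrink.{v} t).symm.nonempty
  have : IsDirectedOrder (Shrink.{v} t) := ⟨fun x y => by
    rcases ht.total ((equivShrink.{v} t).symm x).2 ((equivShrink.{v} t).symm y).2 with h | h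
    · exact ⟨y, h, le_rfl⟩
    · exact ⟨x, le_rfl, h⟩⟩
  have hmon : Monotone fun j : Shrink.{v} t => r ((equivShrink.{v} t).symm j) := fun i j hij => by
    change RecursiveSubobject.toSubobject _ ≤ RecursiveSubobject.toSubobject _
    rw [hrt, hrt]
    exact hij
  obtain ⟨V, hV⟩ := RecursiveSubobject.exists_upperBound hP.isStrongGenerator.isSeparating
    hP.le_isCardinalPresentable hmon
  refine ⟨V, fun x hx => ?_⟩
  have h := hV (equivShrink.{v} t ⟨_, x, hx, rfl⟩)
  change RecursiveSubobject.toSubobject _ ≤ _ at h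
  rw [hrt, Equiv.symm_apply_apply] at h
  exact h

theorem mainTheorem9 {C : Type u} [Category.{v} C] [IsLocallyFinitelyPresentable.{v} C]
    (hC : HasSimpleInitial C) (F : C ⥤ C) [F.PreservesMonomorphisms] :
    HasInitial (Endofunctor.Algebra F) ↔ ∃ A : Endofunctor.Algebra F, IsPreFixedPoint A := by
  constructor
  · intro h
    have := Endofunctor.Algebra.Initial.str_isIso (initialIsInitial (C := Endofunctor.Algebra F))
    exact ⟨⊥_ _, inferInstanceAs (Mono (⊥_ Endofunctor.Algebra F).str)⟩
  · rintro ⟨A, hA⟩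
    have : Mono A.str := hA
    obtain ⟨U, hU⟩ := exists_isMax_recursiveSubobject hC F A
    have := RecursiveSubobject.isIso_str_of_isMax hU
    exact U.isRecursive.isInitial.hasInitial
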